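/- \textbf{Corollary} (Squier). Let $\Sigma=(\Sigma_0,\Sigma_1,\Sigma_2)$ be a convergent $2$-polygraph. Any Squier completion $\mathcal{S}(\Sigma)$ of $\Sigma$ is a coherent presentation of the category presented by $\Sigma$. Here a \emph{$2$-polygraph} $\Sigma$ consists of a directed graph $(\Sigma_0,\Sigma_1)$, generating a free category $\Sigma_1^\ast$ whose morphisms are called $1$-cells, and of a set $\Sigma_2$ of generating $2$-cells $\varphi : p \Rightarrow q$ between parallel $1$-cells. The \emph{category presented by} $\Sigma$ is the quotient of $\Sigma_1^\ast$ by the congruence generated by $\Sigma_2$. We write $\Sigma_2^\top$ for the free $(2,1)$-category generated by $\Sigma$, with $0$-composition written as juxtaposition and $1$-composition written $\star_1$. A \emph{rewriting step} is a $2$-cell $u\varphi v : upv \Rightarrow uqv$, where $\varphi : p\Rightarrow q$ is in $\Sigma_2$ and $u,v$ are $1$-cells; a \emph{rewriting sequence} is a sequence of composable rewriting steps, and a finite one (possibly of length zero) is identified with the $\star_1$-composite of its steps. $\Sigma$ is \emph{convergent} if it is terminating (there is no infinite rewriting sequence) and confluent (for any two finite rewriting sequences $p\Rightarrow q$ and $p\Rightarrow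 r$ with the same source there are finite rewriting sequences $q\Rightarrow s$ and $r\Rightarrow s$ with the same target). A \emph{local branching} is a pair $(f,g)$ of rewriting steps with the same source; it is \emph{aspherical} if $f=g$, and \emph{Peiffer} if, up to exchange of its two members, it is of the form $(f'v,ug')$ for rewriting steps $f'$ of source $u$ and $g'$ of source $v$. A \emph{critical branching} is a local branching that is neither aspherical nor Peiffer and that is minimal for the order on local branchings given by $(f,g)\sqsubseteq (wfw',wgw')$ for $1$-cells $w,w'$. Branchings are considered up to exchange of their two members. A \emph{Squier completion} of $\Sigma$ is $\Sigma$ together with a \emph{family of generating confluences}, that is, a set $\Sigma_3$ of $3$-cells made of exactly one $3$-cell of the form $f\star_1 f' \Rrightarrow g\star_1 g'$ for each critical branching $(f,g)$ of $\Sigma$, where $f'$ and $g'$ are finite rewriting sequences with the same target, starting at the targets of $f$ and of $g$ respectively. The pair $(\Sigma,\Sigma_3)$ is a \emph{coherent presentation} of a category $\mathbf{C}$ if the category presented by $\Sigma$ is isomorphic to $\mathbf{C}$ and $\Sigma_3$ is a homotopy basis of $\Sigma_2^\top$: for any two parallel $2$-cells $f,g$ of $\Sigma_2^\top$ there is a $3$-cell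 from $f$ to $g$ in the free $(3,1)$-category generated by $(\Sigma,\Sigma_3)$. -/

import Mathlib

open CategoryTheory Bicategory

universe u v w t

/-- A `2`-polygraph: `0`-cells, generating `1`-cells, and a globular extension of the free category
on them. The generating `2`-cells with `1`-source `p` and `1`-target `q` (two parallel paths of
generating `1`-cells) form the type `Rule p q`. -/
structure TwoPolygraph where
  /-- the `0`-cells -/
  Obj : Type u
  /-- the generating `1`-cells -/
  [quiver : Quiver.{v} Obj]
  /-- the generating `2`-cells -/
  Rule : ∀ {x y : Obj}, Quiver.Path x y → Quiver.Path x y → Type w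

attribute [instance] TwoPolygraph.quiver

namespace TwoPolygraph

/-- The relation on the free category that is given by the `2`-cells. -/
def homRel (P : TwoPolygraph.{u, v, w}) : HomRel (Paths P.Obj) :=
  fun x y p q => Nonempty (P.Rule (x := x) (y := y) p q)

/-- The category presented by `P`: the quotient of the free category by the congruence generated by
the `2`-cells. -/
abbrev PresentedCategory (P : TwoPolygraph.{u, v, w}) : Type u :=
  CategoryTheory.Quotient P.homRel

/-- `P` is a presentation of `C`: the category presented by `P` is isomorphic to `C`. -/
def Presents (P : TwoPolygraph.{u, v, w}) (C : Type*) [Category* C] : Prop :=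
  ∃ (F : P.PresentedCategory ⥤ C) (G : C ⥤ P.PresentedCategory), F ⋙ G = 𝟭 _ ∧ G ⋙ F = 𝟭 _

/-! ### The free `(2,1)`-category -/

/-- The `0`-cells of the free `(2,1)`-category generated by `P`. -/
def Free (P : TwoPolygraph.{u, v, w}) : Type u := P.Obj

variable {P : TwoPolygraph.{u, v, w}}

/-- The `1`-cells are the paths of generating `1`-cells. -/
instance : CategoryStruct P.Free where
  Hom x y := @Quiver.Path P.Obj _ x y
  id _ := Quiver.Path.nil
  comp p q := Quiver.Path.comp p q

theorem Free.idComp {x y : P.Free} (p : x ⟶ y) : 𝟙 x ≫ p = p := Quiver.Path.nil_comp p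
theorem Free.compId {x y : P.Free} (p : x ⟶ y) : p ≫ 𝟙 y = p := Quiver.Path.comp_nil p
theorem Free.assoc {x y z t : P.Free} (p : x ⟶ y) (q : y ⟶ z) (r : z ⟶ t) :
    (p ≫ q) ≫ r = p ≫ (q ≫ r) := Quiver.Path.comp_assoc p q r

/-- Formal composites of generating `2`-cells and their inverses. -/
inductive FormalCell (P : TwoPolygraph.{u, v, w}) :
    ∀ {x y : P.Free}, (x ⟶ y) → (x ⟶ y) → Type (max u v w)
  /-- a generating `2`-cell -/
  | of {x y : P.Free} {p q : x ⟶ y} (φ : P.Rule p q) : FormalCell P p q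
  /-- the identity of a `1`-cell, between two equal expressions of that `1`-cell -/
  | ofEq {x y : P.Free} {p q : x ⟶ y} (h : p = q) : FormalCell P p q
  /-- `1`-composition -/
  | comp {x y : P.Free} {p q r : x ⟶ y} (f : FormalCell P p q) (g : FormalCell P q r) :
      FormalCell P p r
  /-- inverse for the `1`-composition -/
  | inv {x y : P.Free} {p q : x ⟶ y} (f : FormalCell P p q) : FormalCell P q p
  /-- `0`-composition with a `1`-cell on the left -/
  | whiskerL {x y z : P.Free} (a : x ⟶ y) {p q : y ⟶ z} (f : FormalCell P p q) :
      FormalCell P (a ≫ p) (a ≫ q)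
  /-- `0`-composition with a `1`-cell on the right -/
  | whiskerR {x y z : P.Free} {p q : x ⟶ y} (f : FormalCell P p q) (a : y ⟶ z) :
      FormalCell P (p ≫ a) (q ≫ a)

namespace FormalCell

/-- The congruence on formal composites generated by the axioms of strict `2`-categories and by the
invertibility of `2`-cells. -/
inductive Rel : ∀ {x y : P.Free} {p q : x ⟶ y}, FormalCell P p q → FormalCell P p q → Prop
  -- equivalence relation
  | refl {x y : P.Free} {p q : x ⟶ y} (f : FormalCell P p q) : Rel f f
  | symm {x y : P.Free} {p q : x ⟶ y} {f g : FormalCell P p q} : Rel f g → Rel g f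
  | trans {x y : P.Free} {p q : x ⟶ y} {f g h : FormalCell P p q} : Rel f g → Rel g h → Rel f h
  -- compatibility with the operations
  | comp_congr {x y : P.Free} {p q r : x ⟶ y} {f f' : FormalCell P p q} {g g' : FormalCell P q r} :
      Rel f f' → Rel g g' → Rel (f.comp g) (f'.comp g')
  | inv_congr {x y : P.Free} {p q : x ⟶ y} {f f' : FormalCell P p q} : Rel f f' → Rel f.inv f'.inv
  | whiskerL_congr {x y z : P.Free} (a : x ⟶ y) {p q : y ⟶ z} {f f' : FormalCell P p q} :
      Rel f f' → Rel (whiskerL a f) (whiskerL a f')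
  | whiskerR_congr {x y z : P.Free} {p q : x ⟶ y} {f f' : FormalCell P p q} (a : y ⟶ z) :
      Rel f f' → Rel (whiskerR f a) (whiskerR f' a)
  -- the `1`-cells and `2`-cells between two `0`-cells form a groupoid
  | id_comp {x y : P.Free} {p q : x ⟶ y} (f : FormalCell P p q) : Rel ((ofEq rfl).comp f) f
  | comp_id {x y : P.Free} {p q : x ⟶ y} (f : FormalCell P p q) : Rel (f.comp (ofEq rfl)) f
  | assoc {x y : P.Free} {p q r s : x ⟶ y} (f : FormalCell P p q) (g : FormalCell P q r)
      (h : FormalCell P r s) : Rel ((f.comp g).comp h) (f.comp (g.comp h))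
  | comp_inv {x y : P.Free} {p q : x ⟶ y} (f : FormalCell P p q) : Rel (f.comp f.inv) (ofEq rfl)
  | inv_comp {x y : P.Free} {p q : x ⟶ y} (f : FormalCell P p q) : Rel (f.inv.comp f) (ofEq rfl)
  -- `0`-composition with a `1`-cell is functorial
  | whiskerL_id {x y z : P.Free} (a : x ⟶ y) (p : y ⟶ z) :
      Rel (whiskerL a (ofEq (rfl : p = p))) (ofEq rfl)
  | whiskerL_comp {x y z : P.Free} (a : x ⟶ y) {p q r : y ⟶ z} (f : FormalCell P p q)
      (g : FormalCell P q r) : Rel (whiskerL a (f.comp g)) ((whiskerL a f).comp (whiskerL a g))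
  | whiskerR_id {x y z : P.Free} (p : x ⟶ y) (a : y ⟶ z) :
      Rel (whiskerR (ofEq (rfl : p = p)) a) (ofEq rfl)
  | whiskerR_comp {x y z : P.Free} {p q r : x ⟶ y} (f : FormalCell P p q) (g : FormalCell P q r)
      (a : y ⟶ z) : Rel (whiskerR (f.comp g) a) ((whiskerR f a).comp (whiskerR g a))
  -- `0`-composition is unital and associative
  | whiskerL_one {x y : P.Free} {p q : x ⟶ y} (f : FormalCell P p q) :
      Rel (whiskerL (𝟙 x) f)
        ((ofEq (Free.idComp p)).comp (f.comp (ofEq (Free.idComp q).symm)))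
  | whiskerR_one {x y : P.Free} {p q : x ⟶ y} (f : FormalCell P p q) :
      Rel (whiskerR f (𝟙 y))
        ((ofEq (Free.compId p)).comp (f.comp (ofEq (Free.compId q).symm)))
  | whiskerL_mul {x y z t : P.Free} (a : x ⟶ y) (b : y ⟶ z) {p q : z ⟶ t}
      (f : FormalCell P p q) :
      Rel (whiskerL (a ≫ b) f)
        ((ofEq (Free.assoc a b p)).comp
          ((whiskerL a (whiskerL b f)).comp (ofEq (Free.assoc a b q).symm)))
  | whiskerR_mul {x y z t : P.Free} {p q : x ⟶ y} (f : FormalCell P p q) (a : y ⟶ z)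
      (b : z ⟶ t) :
      Rel (whiskerR f (a ≫ b))
        ((ofEq (Free.assoc p a b).symm).comp
          ((whiskerR (whiskerR f a) b).comp (ofEq (Free.assoc q a b))))
  | whisker_assoc {x y z t : P.Free} (a : x ⟶ y) {p q : y ⟶ z} (f : FormalCell P p q)
      (b : z ⟶ t) :
      Rel (whiskerR (whiskerL a f) b)
        ((ofEq (Free.assoc a p b)).comp
          ((whiskerL a (whiskerR f b)).comp (ofEq (Free.assoc a q b).symm)))
  -- exchange law
  | exchange {x y z : P.Free} {p q : x ⟶ y} {r s : y ⟶ z} (f : FormalCell P p q)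
      (g : FormalCell P r s) :
      Rel ((whiskerL p g).comp (whiskerR f s)) ((whiskerR f r).comp (whiskerL q g))

/-- Equality of formal composites in the free `(2,1)`-category. -/
def setoid {x y : P.Free} (p q : x ⟶ y) : Setoid (FormalCell P p q) :=
  ⟨Rel, Rel.refl, Rel.symm, Rel.trans⟩

end FormalCell

/-- The `2`-cells of the free `(2,1)`-category generated by `P`. -/
def TwoCell {x y : P.Free} (p q : x ⟶ y) : Type (max u v w) := _root_.Quotient (FormalCell.setoid p q)

namespace TwoCell

/-- The class of a formal composite. -/
def mk {x y : P.Free} {p q : x ⟶ y} (f : FormalCell P p q) : TwoCell p q :=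
  Quotient.mk (FormalCell.setoid p q) f

theorem sound {x y : P.Free} {p q : x ⟶ y} {f g : FormalCell P p q} (h : FormalCell.Rel f g) :
    mk f = mk g := Quotient.sound (s := FormalCell.setoid p q) h

theorem ind {x y : P.Free} {p q : x ⟶ y} {motive : TwoCell p q → Prop}
    (h : ∀ f : FormalCell P p q, motive (mk f)) (f : TwoCell p q) : motive f :=
  Quotient.ind (s := FormalCell.setoid p q) h f

/-- The `1`-composition. -/
def comp {x y : P.Free} {p q r : x ⟶ y} : TwoCell p q → TwoCell q r → TwoCell p r :=
  Quotient.map₂ FormalCell.comp (fun _ _ h _ _ h' => FormalCell.Rel.comp_congr h h')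

/-- The inverse for the `1`-composition. -/
def inv {x y : P.Free} {p q : x ⟶ y} : TwoCell p q → TwoCell q p :=
  Quotient.map FormalCell.inv (fun _ _ h => FormalCell.Rel.inv_congr h)

/-- `0`-composition with a `1`-cell on the left. -/
def whiskerL {x y z : P.Free} (a : x ⟶ y) {p q : y ⟶ z} :
    TwoCell p q → TwoCell (a ≫ p) (a ≫ q) :=
  Quotient.map (FormalCell.whiskerL a) (fun _ _ h => FormalCell.Rel.whiskerL_congr a h)

/-- `0`-composition with a `1`-cell on the right. -/
def whiskerR {x y z : P.Free} {p q : x ⟶ y} (f : TwoCell p q) (a : y ⟶ z) :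
    TwoCell (p ≫ a) (q ≫ a) :=
  Quotient.map (fun f => FormalCell.whiskerR f a)
    (fun _ _ h => FormalCell.Rel.whiskerR_congr a h) f

end TwoCell

instance homGroupoid (x y : P.Free) : Groupoid (x ⟶ y) where
  Hom p q := TwoCell p q
  id p := TwoCell.mk (FormalCell.ofEq rfl)
  comp f g := TwoCell.comp f g
  inv f := TwoCell.inv f
  id_comp f := by
    induction f using TwoCell.ind with | h f => exact TwoCell.sound (.id_comp f)
  comp_id f := by
    induction f using TwoCell.ind with | h f => exact TwoCell.sound (.comp_id f)
  assoc f g h := by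
    induction f using TwoCell.ind with | h f =>
    induction g using TwoCell.ind with | h g =>
    induction h using TwoCell.ind with | h h => exact TwoCell.sound (.assoc f g h)
  inv_comp f := by
    induction f using TwoCell.ind with | h f => exact TwoCell.sound (.inv_comp f)
  comp_inv f := by
    induction f using TwoCell.ind with | h f => exact TwoCell.sound (.comp_inv f)

theorem mk_ofEq {x y : P.Free} {p q : x ⟶ y} (h : p = q) :
    (TwoCell.mk (FormalCell.ofEq h) : p ⟶ q) = eqToHom h := by
  subst h; rfl

theorem whiskerL_eqToHom {x y z : P.Free} (a : x ⟶ y) {p q : y ⟶ z} (h : p = q) :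
    (TwoCell.whiskerL a (eqToHom h : p ⟶ q) : a ≫ p ⟶ a ≫ q) =
      eqToHom (congrArg (fun r => a ≫ r) h) := by
  subst h; exact TwoCell.sound (.whiskerL_id a p)

theorem whiskerR_eqToHom {x y z : P.Free} {p q : x ⟶ y} (h : p = q) (a : y ⟶ z) :
    (TwoCell.whiskerR (eqToHom h : p ⟶ q) a : p ≫ a ⟶ q ≫ a) =
      eqToHom (congrArg (fun r => r ≫ a) h) := by
  subst h; exact TwoCell.sound (.whiskerR_id p a)

/-- The free `(2,1)`-category generated by `P`. -/
instance : Bicategory P.Free where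
  homCategory x y := (homGroupoid x y).toCategory
  whiskerLeft a _ _ f := TwoCell.whiskerL a f
  whiskerRight f a := TwoCell.whiskerR f a
  associator p q r := eqToIso (Free.assoc p q r)
  leftUnitor p := eqToIso (Free.idComp p)
  rightUnitor p := eqToIso (Free.compId p)
  whiskerLeft_id a p := TwoCell.sound (.whiskerL_id a p)
  whiskerLeft_comp a _ _ _ f g := by
    induction f using TwoCell.ind with | h f =>
    induction g using TwoCell.ind with | h g => exact TwoCell.sound (.whiskerL_comp a f g)
  id_whiskerLeft {_ _ p q} f := by
    induction f using TwoCell.ind with | h f =>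
    refine (TwoCell.sound (.whiskerL_one f)).trans ?_
    rw [eqToIso.hom, eqToIso.inv, ← mk_ofEq, ← mk_ofEq]; rfl
  comp_whiskerLeft a b _ _ f := by
    induction f using TwoCell.ind with | h f =>
    refine (TwoCell.sound (.whiskerL_mul a b f)).trans ?_
    rw [eqToIso.hom, eqToIso.inv, ← mk_ofEq, ← mk_ofEq]; rfl
  id_whiskerRight p a := TwoCell.sound (.whiskerR_id p a)
  comp_whiskerRight f g a := by
    induction f using TwoCell.ind with | h f =>
    induction g using TwoCell.ind with | h g => exact TwoCell.sound (.whiskerR_comp f g a)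
  whiskerRight_id f := by
    induction f using TwoCell.ind with | h f =>
    refine (TwoCell.sound (.whiskerR_one f)).trans ?_
    rw [eqToIso.hom, eqToIso.inv, ← mk_ofEq, ← mk_ofEq]; rfl
  whiskerRight_comp f a b := by
    induction f using TwoCell.ind with | h f =>
    refine (TwoCell.sound (.whiskerR_mul f a b)).trans ?_
    rw [eqToIso.hom, eqToIso.inv, ← mk_ofEq, ← mk_ofEq]; rfl
  whisker_assoc a _ _ f b := by
    induction f using TwoCell.ind with | h f =>
    refine (TwoCell.sound (.whisker_assoc a f b)).trans ?_
    rw [eqToIso.hom, eqToIso.inv, ← mk_ofEq, ← mk_ofEq]; rfl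
  whisker_exchange f g := by
    induction f using TwoCell.ind with | h f =>
    induction g using TwoCell.ind with | h g => exact TwoCell.sound (.exchange f g)
  pentagon p q r s := by
    simp only [eqToIso.hom, whiskerL_eqToHom, whiskerR_eqToHom, eqToHom_trans]
  triangle p q := by
    simp only [eqToIso.hom, whiskerL_eqToHom, whiskerR_eqToHom, eqToHom_trans]

instance : Bicategory.Strict P.Free where
  id_comp := Free.idComp
  comp_id := Free.compId
  assoc := Free.assoc
  leftUnitor_eqToIso _ := rfl
  rightUnitor_eqToIso _ := rfl
  associator_eqToIso _ _ _ := rfl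

/-- All `2`-cells are invertible. -/
theorem Free.isLocallyGroupoid : Bicategory.IsLocallyGroupoid P.Free :=
  fun x y => ⟨fun f => ⟨(homGroupoid x y).inv f,
    (homGroupoid x y).comp_inv f, (homGroupoid x y).inv_comp f⟩⟩

/-- A generating `2`-cell, as a `2`-cell of the free `(2,1)`-category. -/
def ofRule {x y : P.Free} {p q : x ⟶ y} (φ : P.Rule p q) : p ⟶ q :=
  TwoCell.mk (FormalCell.of φ)

/-! ### Rewriting -/

/-- A rewriting step `left φ right` between `1`-cells from `x` to `y`, where `φ` is a generating
`2`-cell. -/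
structure Step (P : TwoPolygraph.{u, v, w}) (x y : P.Free) where
  {a : P.Free}
  {b : P.Free}
  left : x ⟶ a
  {p : a ⟶ b}
  {q : a ⟶ b}
  rule : P.Rule p q
  right : b ⟶ y

namespace Step

variable {x y : P.Free}

/-- The `1`-source of a rewriting step. -/
def src (f : P.Step x y) : x ⟶ y := f.left ≫ f.p ≫ f.right

/-- The `1`-target of a rewriting step. -/
def tgt (f : P.Step x y) : x ⟶ y := f.left ≫ f.q ≫ f.right

/-- The `2`-cell of the free `(2,1)`-category defined by a rewriting step. -/
def toCell (f : P.Step x y) : f.src ⟶ f.tgt := f.left ◁ ofRule f.rule ▷ f.right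

/-- The rewriting step `c f d`. -/
def whisker {x' y' : P.Free} (c : x' ⟶ x) (f : P.Step x y) (d : y ⟶ y') : P.Step x' y' where
  left := c ≫ f.left
  rule := f.rule
  right := f.right ≫ d

theorem whisker_src {x' y' : P.Free} (c : x' ⟶ x) (f : P.Step x y) (d : y ⟶ y') :
    (f.whisker c d).src = c ≫ f.src ≫ d := by
  simp only [src, whisker, Free.assoc]

end Step

/-- Finite rewriting sequences (possibly of length zero) from a `1`-cell to another one. -/
inductive RewritingSequence {x y : P.Free} : (x ⟶ y) → (x ⟶ y) → Type (max u v w)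
  | nil (p : x ⟶ y) : RewritingSequence p p
  | cons {p q : x ⟶ y} (f : P.Step x y) (h : f.src = p) (s : RewritingSequence f.tgt q) :
      RewritingSequence p q

/-- The `2`-cell `f₀ ⋆₁ f₁ ⋆₁ ⋯ ⋆₁ fₙ` defined by a finite rewriting sequence. -/
def RewritingSequence.toCell {x y : P.Free} {p q : x ⟶ y} : RewritingSequence p q → (p ⟶ q)
  | .nil p => 𝟙 p
  | .cons f h s => eqToHom h.symm ≫ f.toCell ≫ s.toCell

/-- There is no infinite rewriting sequence. -/
def Terminating (P : TwoPolygraph.{u, v, w}) : Prop :=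
  ∀ x y : P.Free, ¬ ∃ p : ℕ → (x ⟶ y), ∀ n, ∃ f : P.Step x y, f.src = p n ∧ f.tgt = p (n + 1)

/-- Every branching of finite rewriting sequences can be completed by a confluence. -/
def Confluent (P : TwoPolygraph.{u, v, w}) : Prop :=
  ∀ {x y : P.Free} {p q r : x ⟶ y}, RewritingSequence p q → RewritingSequence p r →
    ∃ s : x ⟶ y, Nonempty (RewritingSequence q s) ∧ Nonempty (RewritingSequence r s)

/-- A convergent `2`-polygraph. -/
def Convergent (P : TwoPolygraph.{u, v, w}) : Prop := P.Confluent ∧ P.Terminating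

/-- A local branching: a pair of rewriting steps with a common source. -/
structure LocalBranching (P : TwoPolygraph.{u, v, w}) where
  {x : P.Free}
  {y : P.Free}
  fst : P.Step x y
  snd : P.Step x y
  src_eq : fst.src = snd.src

namespace LocalBranching

/-- The local branching `(g, f)`. -/
def swap (B : P.LocalBranching) : P.LocalBranching := ⟨B.snd, B.fst, B.src_eq.symm⟩

/-- The local branching `(c f d, c g d)`. -/
def whisker {x' y' : P.Free} (B : P.LocalBranching) (c : x' ⟶ B.x) (d : B.y ⟶ y') :
    P.LocalBranching :=
  ⟨B.fst.whisker c d, B.snd.whisker c d, by rw [Step.whisker_src, Step.whisker_src, B.src_eq]⟩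

/-- `(f, f)`. -/
def IsAspherical (B : P.LocalBranching) : Prop := B.fst = B.snd

/-- `(f v, u g)` or `(u g, f v)`, for rewriting steps `f` of source `u` and `g` of source `v`. -/
def IsPeiffer (B : P.LocalBranching) : Prop :=
  ∃ (z : P.Free) (f : P.Step B.x z) (g : P.Step z B.y),
    (B.fst = f.whisker (𝟙 _) g.src ∧ B.snd = g.whisker f.src (𝟙 _)) ∨
    (B.snd = f.whisker (𝟙 _) g.src ∧ B.fst = g.whisker f.src (𝟙 _))

/-- A local branching that is neither aspherical nor Peiffer. -/
def IsOverlapping (B : P.LocalBranching) : Prop := ¬ B.IsAspherical ∧ ¬ B.IsPeiffer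

/-- The order on local branchings: `(f, g) ⊑ (c f d, c g d)`. -/
def Below (B B' : P.LocalBranching) : Prop :=
  ∃ (x' y' : P.Free) (c : x' ⟶ B.x) (d : B.y ⟶ y'), B' = B.whisker c d

/-- An overlapping branching that is minimal for the order `Below`. -/
def IsCritical (B : P.LocalBranching) : Prop :=
  B.IsOverlapping ∧ ∀ B' : P.LocalBranching, B'.Below B → B' = B

end LocalBranching

/-! ### Globular extensions of the free `(2,1)`-category -/

/-- A `2`-sphere: a pair of parallel `2`-cells of the free `(2,1)`-category. -/
structure TwoSphere (P : TwoPolygraph.{u, v, w}) where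
  {x : P.Free}
  {y : P.Free}
  {p : x ⟶ y}
  {q : x ⟶ y}
  fst : p ⟶ q
  snd : p ⟶ q

/-- A globular extension of the free `(2,1)`-category generated by `P`: a set of `3`-cells `A`, with
`boundary A` the `2`-sphere formed by the `2`-source and the `2`-target of `A`. -/
structure GlobularExtension (P : TwoPolygraph.{u, v, w}) where
  Cell : Type t
  boundary : Cell → P.TwoSphere

namespace GlobularExtension

/-- Formal composites of the `3`-cells of `E`. The `3`-cells of the free `(3,1)`-category generated
by `E` are the classes of these formal composites modulo the axioms of `(3,1)`-categories, so there
is a `3`-cell from `f` to `g` in that category if and only if `E.ThreeCell f g` is nonempty. -/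
inductive ThreeCell (E : GlobularExtension.{u, v, w, t} P) :
    ∀ {x y : P.Free} {p q : x ⟶ y}, (p ⟶ q) → (p ⟶ q) → Type (max u v w t)
  /-- a `3`-cell of the extension -/
  | of (A : E.Cell) : ThreeCell E (E.boundary A).fst (E.boundary A).snd
  /-- the identity of a `2`-cell -/
  | id {x y : P.Free} {p q : x ⟶ y} (f : p ⟶ q) : ThreeCell E f f
  /-- the inverse for the `2`-composition -/
  | inv {x y : P.Free} {p q : x ⟶ y} {f g : p ⟶ q} : ThreeCell E f g → ThreeCell E g f
  /-- the `2`-composition -/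
  | comp₂ {x y : P.Free} {p q : x ⟶ y} {f g h : p ⟶ q} :
      ThreeCell E f g → ThreeCell E g h → ThreeCell E f h
  /-- the `1`-composition -/
  | comp₁ {x y : P.Free} {p q r : x ⟶ y} {f f' : p ⟶ q} {g g' : q ⟶ r} :
      ThreeCell E f f' → ThreeCell E g g' → ThreeCell E (f ≫ g) (f' ≫ g')
  /-- the `0`-composition -/
  | comp₀ {x y z : P.Free} {p q : x ⟶ y} {r s : y ⟶ z} {f f' : p ⟶ q} {g g' : r ⟶ s} :
      ThreeCell E f f' → ThreeCell E g g' → ThreeCell E (f ▷ r ≫ q ◁ g) (f' ▷ r ≫ q ◁ g')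

/-- `E` is a homotopy basis: for every `2`-sphere `(f, g)` of the free `(2,1)`-category, there is a
`3`-cell from `f` to `g` in the free `(3,1)`-category. -/
def IsHomotopyBasis (E : GlobularExtension.{u, v, w, t} P) : Prop :=
  ∀ {x y : P.Free} {p q : x ⟶ y} (f g : p ⟶ q), Nonempty (E.ThreeCell f g)

/-- The `2`-sphere `S` is of the form `(f ⋆₁ f', g ⋆₁ g')`, where `B = (f, g)` and `(f', g')` is a
confluence completing `B`. -/
def IsConfluenceOf (S : P.TwoSphere) (B : P.LocalBranching) : Prop :=
  ∃ (r : B.x ⟶ B.y) (f' : RewritingSequence B.fst.tgt r) (g' : RewritingSequence B.snd.tgt r),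
    S = ⟨B.fst.toCell ≫ f'.toCell, eqToHom B.src_eq ≫ B.snd.toCell ≫ g'.toCell⟩

/-- `E` is a family of generating confluences: it is made of exactly one `3`-cell, filling a
confluence diagram, for each critical branching. Branchings are considered up to exchange of
their two members, as `(f, g)` and `(g, f)` have the same confluence diagrams up to orientation:
`branching A` is the critical branching, in the orientation given by the `3`-cell `A`. -/
def IsFamilyOfGeneratingConfluences (E : GlobularExtension.{u, v, w, t} P) : Prop :=
  ∃ branching : E.Cell → P.LocalBranching,
    (∀ A, (branching A).IsCritical ∧ IsConfluenceOf (E.boundary A) (branching A)) ∧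
    ∀ B : P.LocalBranching, B.IsCritical → ∃! A : E.Cell, branching A = B ∨ branching A = B.swap

end GlobularExtension

end TwoPolygraph

/-- A `(3,1)`-polygraph: a `2`-polygraph with a globular extension of its free `(2,1)`-category. -/
structure ThreeOnePolygraph where
  base : TwoPolygraph.{u, v, w}
  ext : TwoPolygraph.GlobularExtension.{u, v, w, t} base

namespace ThreeOnePolygraph

/-- `S` is an extended presentation of the category `C`. -/
def IsExtendedPresentation (S : ThreeOnePolygraph.{u, v, w, t}) (C : Type*) [Category* C] : Prop :=
  S.base.Presents C

/-- `S` is a coherent presentation of the category `C`. -/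
def IsCoherentPresentation (S : ThreeOnePolygraph.{u, v, w, t}) (C : Type*) [Category* C] : Prop :=
  S.IsExtendedPresentation C ∧ S.ext.IsHomotopyBasis

end ThreeOnePolygraph

/-- A Squier completion of a `2`-polygraph `P`: a `(3,1)`-polygraph that extends `P` by a chosen
family of generating confluences. -/
structure SquierCompletion (P : TwoPolygraph.{u, v, w}) where
  ext : TwoPolygraph.GlobularExtension.{u, v, w, t} P
  isFamily : ext.IsFamilyOfGeneratingConfluences

/-- The `(3,1)`-polygraph underlying a Squier completion. -/
def SquierCompletion.toThreeOnePolygraph {P : TwoPolygraph.{u, v, w}}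
    (S : SquierCompletion.{u, v, w, t} P) : ThreeOnePolygraph.{u, v, w, t} := ⟨P, S.ext⟩

/-! The presentation half is immediate, the category being the presented one itself. For the
homotopy basis, every local branching is first completed to a confluence filled by a `3`-cell
(`IsFamilyOfGeneratingConfluences.fills`): trivially if aspherical, by the exchange law if Peiffer,
and otherwise by putting in context the generating confluence of a critical branching below it.
Noetherian induction, as in Newman's lemma, then connects by a `3`-cell any two rewriting sequences
from `p` to its normal form (`Sim.of_normal`). Finally every `2`-cell `f : p ⟶ q` satisfies `s ~ f
⋆₁ t` for some reductions `s`, `t` of `p`, `q` to a common normal form (`Coherent.all`, by induction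
on formal composites). For parallel `f` and `g` this gives `f ⋆₁ t ~ g ⋆₁ t`, and `t` cancels
because `2`-cells are invertible. -/

namespace TwoPolygraph

variable {P : TwoPolygraph.{u, v, w}}

/-! ### Structural `2`-cells and contexts. -/

instance {x y : P.Free} {p q : x ⟶ y} (f : p ⟶ q) : IsIso f :=
  (Free.isLocallyGroupoid x y).all_isIso f

/-- The structural isomorphisms are rewritten as `eqToHom`, so that `simp` can merge and cancel
them: associativity and unitality of `1`-cells are equalities, but not definitional ones. -/
theorem associator_hom {x y z t : P.Free} (p : x ⟶ y) (q : y ⟶ z) (r : z ⟶ t) :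
    (α_ p q r).hom = eqToHom (Free.assoc p q r) := rfl

theorem associator_inv {x y z t : P.Free} (p : x ⟶ y) (q : y ⟶ z) (r : z ⟶ t) :
    (α_ p q r).inv = eqToHom (Free.assoc p q r).symm := rfl

theorem leftUnitor_hom {x y : P.Free} (p : x ⟶ y) : (λ_ p).hom = eqToHom (Free.idComp p) := rfl

theorem leftUnitor_inv {x y : P.Free} (p : x ⟶ y) :
    (λ_ p).inv = eqToHom (Free.idComp p).symm := rfl

theorem rightUnitor_hom {x y : P.Free} (p : x ⟶ y) : (ρ_ p).hom = eqToHom (Free.compId p) := rfl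

theorem rightUnitor_inv {x y : P.Free} (p : x ⟶ y) :
    (ρ_ p).inv = eqToHom (Free.compId p).symm := rfl

/-- The `2`-cell `c f d`, for `1`-cells `c` and `d`. -/
def context {x' x y y' : P.Free} (c : x' ⟶ x) {p q : x ⟶ y} (f : p ⟶ q) (d : y ⟶ y') :
    c ≫ p ≫ d ⟶ c ≫ q ≫ d := c ◁ f ▷ d

section context

variable {x' x y y' : P.Free} (c : x' ⟶ x) (d : y ⟶ y')

theorem context_eqToHom {p q : x ⟶ y} (h : p = q) :
    context c (eqToHom h) d = eqToHom (by rw [h]) := by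
  subst h; simp [context]

theorem context_id (p : x ⟶ y) : context c (𝟙 p) d = 𝟙 _ := by
  simp [context]

theorem context_comp {p q r : x ⟶ y} (f : p ⟶ q) (g : q ⟶ r) :
    context c (f ≫ g) d = context c f d ≫ context c g d := by
  simp [context]

theorem context_inv {p q : x ⟶ y} (f : p ⟶ q) : context c (inv f) d = inv (context c f d) := by
  simp [context]

theorem context_context {x'' y'' : P.Free} (c' : x'' ⟶ x') (d' : y' ⟶ y'') {p q : x ⟶ y}
    (f : p ⟶ q) :
    context c' (context c f d) d' =
      eqToHom (by simp only [Free.assoc]) ≫ context (c' ≫ c) f (d ≫ d') ≫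
        eqToHom (by simp only [Free.assoc]) := by
  simp [context, associator_hom, associator_inv]

theorem comp_context_comp {x'' y'' : P.Free} (c' : x'' ⟶ x') (d' : y' ⟶ y'') {p q : x ⟶ y}
    (f : p ⟶ q) :
    context (c' ≫ c) f (d ≫ d') =
      eqToHom (by simp only [Free.assoc]) ≫ context c' (context c f d) d' ≫
        eqToHom (by simp only [Free.assoc]) := by
  simp [context_context]

theorem context_one_one {p q : x ⟶ y} (f : p ⟶ q) :
    context (𝟙 x) f (𝟙 y) = eqToHom (by simp only [Free.idComp, Free.compId]) ≫ f ≫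
        eqToHom (by simp only [Free.idComp, Free.compId]) := by
  simp [context, leftUnitor_hom, leftUnitor_inv, rightUnitor_hom, rightUnitor_inv]

/-- One-sided whiskering becomes a context with an identity on the other side, so that a single
operation has to be handled later. -/
theorem whiskerLeft_eq_context {p q : x ⟶ y} (f : p ⟶ q) :
    c ◁ f = eqToHom (by simp only [Free.compId]) ≫ context c f (𝟙 y) ≫
        eqToHom (by simp only [Free.compId]) := by
  simp [context, rightUnitor_hom, rightUnitor_inv]

theorem whiskerRight_eq_context {p q : x ⟶ y} (f : p ⟶ q) :
    f ▷ d = eqToHom (by simp only [Free.idComp]) ≫ context (𝟙 x) f d ≫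
        eqToHom (by simp only [Free.idComp]) := by
  simp [context, leftUnitor_hom, leftUnitor_inv]

end context

/-! ### Rewriting steps and sequences in context. -/

namespace Step

variable {x y : P.Free}

theorem whisker_tgt {x' y' : P.Free} (c : x' ⟶ x) (f : P.Step x y) (d : y ⟶ y') :
    (f.whisker c d).tgt = c ≫ f.tgt ≫ d := by
  simp only [tgt, whisker, Free.assoc]

theorem whisker_whisker {x' y' x'' y'' : P.Free} (c' : x'' ⟶ x') (c : x' ⟶ x) (f : P.Step x y)
    (d : y ⟶ y') (d' : y' ⟶ y'') :
    (f.whisker c d).whisker c' d' = f.whisker (c' ≫ c) (d ≫ d') := by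
  simp only [whisker, Free.assoc]

theorem whisker_id (f : P.Step x y) : f.whisker (𝟙 x) (𝟙 y) = f := by
  simp only [whisker, Free.idComp, Free.compId]

theorem whisker_toCell {x' y' : P.Free} (c : x' ⟶ x) (f : P.Step x y) (d : y ⟶ y') :
    (f.whisker c d).toCell =
      eqToHom (whisker_src c f d) ≫ context c f.toCell d ≫ eqToHom (whisker_tgt c f d).symm :=
  comp_context_comp f.left f.right c d (ofRule f.rule)

end Step

namespace RewritingSequence

variable {x y : P.Free}

/-- A rewriting sequence with another expression of its source. -/
def copy {p p' q : x ⟶ y} (h : p' = p) (s : RewritingSequence p q) : RewritingSequence p' q :=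
  h ▸ s

theorem toCell_copy {p p' q : x ⟶ y} (h : p' = p) (s : RewritingSequence p q) :
    (s.copy h).toCell = eqToHom h ≫ s.toCell := by
  subst h; simp [copy]

/-- Concatenation of rewriting sequences. -/
def append {p q r : x ⟶ y} : RewritingSequence p q → RewritingSequence q r → RewritingSequence p r
  | .nil _, t => t
  | .cons f h s, t => .cons f h (s.append t)

theorem toCell_append {p q r : x ⟶ y} (s : RewritingSequence p q) (t : RewritingSequence q r) :
    (s.append t).toCell = s.toCell ≫ t.toCell := by
  induction s with
  | nil p => simp [append, toCell]
  | cons f h s ih => simp [append, toCell, ih]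

/-- The rewriting sequence `c s d`. -/
def whisker {x' y' : P.Free} (c : x' ⟶ x) {p q : x ⟶ y} (d : y ⟶ y') :
    RewritingSequence p q → RewritingSequence (c ≫ p ≫ d) (c ≫ q ≫ d)
  | .nil _ => .nil _
  | .cons f h s => .cons (f.whisker c d) (by rw [Step.whisker_src, h])
      -- The whiskered tail starts at `c ≫ f.tgt ≫ d`, which equals the target of `f.whisker c d`
      -- only after reassociation.
      ((s.whisker c d).copy (Step.whisker_tgt c f d))

theorem toCell_whisker {x' y' : P.Free} (c : x' ⟶ x) {p q : x ⟶ y} (d : y ⟶ y')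
    (s : RewritingSequence p q) : (s.whisker c d).toCell = context c s.toCell d := by
  induction s with
  | nil p => simp [whisker, toCell, context_id]
  | cons f h s ih =>
    simp [whisker, toCell, toCell_copy, ih, Step.whisker_toCell, context_comp, context_eqToHom]

end RewritingSequence

/-! ### Normal forms -/

/-- A `1`-cell that is the source of no rewriting step. -/
def IsNormal {x y : P.Free} (p : x ⟶ y) : Prop := ∀ f : P.Step x y, f.src ≠ p

theorem IsNormal.eq {x y : P.Free} {p q : x ⟶ y} (hp : IsNormal p) (s : RewritingSequence p q) :
    p = q := by
  cases s with
  | nil => rfl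
  | cons f h s => exact absurd h (hp f)

/-- The two legs of a confluence closing `s` and `s'` start at normal forms, hence have length zero.
-/
theorem Confluent.normal_unique (hP : P.Confluent) {x y : P.Free} {p n n' : x ⟶ y}
    (hn : IsNormal n) (hn' : IsNormal n') (s : RewritingSequence p n)
    (s' : RewritingSequence p n') : n = n' := by
  obtain ⟨r, ⟨a⟩, ⟨b⟩⟩ := hP s s'
  exact (hn.eq a).trans (hn'.eq b).symm

theorem Terminating.wellFounded (hP : P.Terminating) (x y : P.Free) :
    WellFounded fun q p : x ⟶ y => ∃ f : P.Step x y, f.src = p ∧ f.tgt = q := by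
  rw [wellFounded_iff_isEmpty_descending_chain]
  exact ⟨fun ⟨p, hp⟩ => hP x y ⟨p, hp⟩⟩

theorem Terminating.exists_normal (hP : P.Terminating) {x y : P.Free} (p : x ⟶ y) :
    ∃ n, IsNormal n ∧ Nonempty (RewritingSequence p n) := by
  induction p using (hP.wellFounded x y).induction with
  | _ p ih =>
    by_cases hp : IsNormal p
    · exact ⟨p, hp, ⟨.nil p⟩⟩
    · simp only [IsNormal, not_forall, not_not] at hp
      obtain ⟨f, hf⟩ := hp
      obtain ⟨n, hn, ⟨s⟩⟩ := ih f.tgt ⟨f, hf, rfl⟩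
      exact ⟨n, hn, ⟨.cons f hf s⟩⟩

/-! ### Critical branchings -/

namespace LocalBranching

theorem IsAspherical.whisker {B : P.LocalBranching} (hB : B.IsAspherical) {x' y' : P.Free}
    (c : x' ⟶ B.x) (d : B.y ⟶ y') : (B.whisker c d).IsAspherical :=
  congrArg (fun f => Step.whisker c f d) hB

/-- The left context is absorbed by `f` and the right one by `g`: the new witnesses are `c f` and `g
d`. -/
theorem IsPeiffer.whisker {B : P.LocalBranching} (hB : B.IsPeiffer) {x' y' : P.Free}
    (c : x' ⟶ B.x) (d : B.y ⟶ y') : (B.whisker c d).IsPeiffer := by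
  obtain ⟨z, f, g, h⟩ := hB
  have hf : (f.whisker (𝟙 _) g.src).whisker c d =
      (f.whisker c (𝟙 _)).whisker (𝟙 _) (g.whisker (𝟙 _) d).src := by
    simp only [Step.whisker_whisker, Step.whisker_src, Free.idComp, Free.compId]
  have hg : (g.whisker f.src (𝟙 _)).whisker c d =
      (g.whisker (𝟙 _) d).whisker (f.whisker c (𝟙 _)).src (𝟙 _) := by
    simp only [Step.whisker_whisker, Step.whisker_src, Free.idComp, Free.compId]
  exact ⟨z, f.whisker c (𝟙 _), g.whisker (𝟙 _) d, h.imp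
    (fun h => ⟨(congrArg (Step.whisker c · d) h.1).trans hf,
      (congrArg (Step.whisker c · d) h.2).trans hg⟩)
    (fun h => ⟨(congrArg (Step.whisker c · d) h.1).trans hf,
      (congrArg (Step.whisker c · d) h.2).trans hg⟩)⟩

theorem whisker_id (B : P.LocalBranching) : B.whisker (𝟙 _) (𝟙 _) = B := by
  cases B; simp only [whisker, Step.whisker_id]

theorem whisker_whisker (B : P.LocalBranching) {x' y' x'' y'' : P.Free}
    (c : x' ⟶ B.x) (d : B.y ⟶ y') (c' : x'' ⟶ x') (d' : y' ⟶ y'') :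
    (B.whisker c d).whisker c' d' = B.whisker (c' ≫ c) (d ≫ d') := by
  simp only [whisker, Step.whisker_whisker]

theorem Below.trans {B B' B'' : P.LocalBranching} (h : B.Below B') (h' : B'.Below B'') :
    B.Below B'' := by
  obtain ⟨x', y', c, d, rfl⟩ := h
  obtain ⟨x'', y'', c', d', rfl⟩ := h'
  exact ⟨_, _, _, _, whisker_whisker B c d c' d'⟩

/-- The length of the source. -/
def length (B : P.LocalBranching) : ℕ := Quiver.Path.length (V := P.Obj) B.fst.src

theorem length_whisker (B : P.LocalBranching) {x' y' : P.Free} (c : x' ⟶ B.x) (d : B.y ⟶ y') :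
    (B.whisker c d).length = Quiver.Path.length (V := P.Obj) c +
      (B.length + Quiver.Path.length (V := P.Obj) d) := by
  rw [length, whisker, Step.whisker_src]
  exact (Quiver.Path.length_comp _ _).trans (congrArg _ (Quiver.Path.length_comp _ _))

/-- Without a strict increase both contexts have length zero, so they are identities and the
branchings coincide. -/
theorem Below.length_lt {B B' : P.LocalBranching} (h : B.Below B') (hne : B ≠ B') :
    B.length < B'.length := by
  obtain ⟨x', y', c, d, rfl⟩ := h
  rw [length_whisker]
  by_contra hlt
  have hc : Quiver.Path.length (V := P.Obj) c = 0 := by omega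
  have hd : Quiver.Path.length (V := P.Obj) d = 0 := by omega
  obtain rfl := Quiver.Path.eq_of_length_zero c hc
  obtain rfl := Quiver.Path.eq_of_length_zero d hd
  obtain rfl := Quiver.Path.eq_nil_of_length_zero c hc
  obtain rfl := Quiver.Path.eq_nil_of_length_zero d hd
  exact hne B.whisker_id.symm

theorem IsOverlapping.of_below {B B' : P.LocalBranching} (h : B.Below B') (hB : B'.IsOverlapping) :
    B.IsOverlapping := by
  obtain ⟨x', y', c, d, rfl⟩ := h
  exact ⟨fun h => hB.1 (h.whisker c d), fun h => hB.2 (h.whisker c d)⟩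

/-- Descent on the length of the source. Everything below an overlapping branching is again
overlapping, so the descent never leaves the overlapping ones. -/
theorem IsOverlapping.exists_critical {B : P.LocalBranching} (hB : B.IsOverlapping) :
    ∃ B' : P.LocalBranching, B'.IsCritical ∧ B'.Below B := by
  by_cases h : ∀ B' : P.LocalBranching, B'.Below B → B' = B
  · exact ⟨B, ⟨hB, h⟩, _, _, 𝟙 _, 𝟙 _, B.whisker_id.symm⟩
  · push Not at h
    obtain ⟨B', hB', hne⟩ := h
    have := hB'.length_lt hne
    obtain ⟨C, hC, hCB⟩ := (hB.of_below hB').exists_critical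
    exact ⟨C, hC, hCB.trans hB'⟩
termination_by B.length

end LocalBranching

/-! ### Existence of a `3`-cell as a congruence. -/

namespace GlobularExtension

variable (E : GlobularExtension.{u, v, w, t} P) {x y : P.Free}

/-- There is a `3`-cell from `f` to `g` in the free `(3,1)`-category. -/
def Sim {p q : x ⟶ y} (f g : p ⟶ q) : Prop := Nonempty (E.ThreeCell f g)

variable {E}

theorem Sim.refl {p q : x ⟶ y} (f : p ⟶ q) : E.Sim f f := ⟨.id f⟩

theorem Sim.of_eq {p q : x ⟶ y} {f g : p ⟶ q} (h : f = g) : E.Sim f g := h ▸ .refl f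

theorem Sim.symm {p q : x ⟶ y} {f g : p ⟶ q} : E.Sim f g → E.Sim g f
  | ⟨a⟩ => ⟨.inv a⟩

theorem Sim.trans {p q : x ⟶ y} {f g h : p ⟶ q} : E.Sim f g → E.Sim g h → E.Sim f h
  | ⟨a⟩, ⟨b⟩ => ⟨.comp₂ a b⟩

theorem Sim.comp {p q r : x ⟶ y} {f f' : p ⟶ q} {g g' : q ⟶ r} :
    E.Sim f f' → E.Sim g g' → E.Sim (f ≫ g) (f' ≫ g')
  | ⟨a⟩, ⟨b⟩ => ⟨.comp₁ a b⟩

theorem Sim.comp_left {p q r : x ⟶ y} (f : p ⟶ q) {g g' : q ⟶ r} (h : E.Sim g g') :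
    E.Sim (f ≫ g) (f ≫ g') := (Sim.refl f).comp h

theorem Sim.comp_right {p q r : x ⟶ y} {f f' : p ⟶ q} (h : E.Sim f f') (g : q ⟶ r) :
    E.Sim (f ≫ g) (f' ≫ g) := h.comp (.refl g)

theorem Sim.of_comp_right {p q r : x ⟶ y} {f f' : p ⟶ q} {g : q ⟶ r}
    (h : E.Sim (f ≫ g) (f' ≫ g)) : E.Sim f f' := by
  simpa using h.comp_right (inv g)

/-- `0`-composition with the identity `3`-cell of `𝟙 d`, then of `𝟙 c`, amounts to whiskering, since
one factor of `comp₀` becomes an identity. -/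
theorem Sim.context {x' y' : P.Free} (c : x' ⟶ x) (d : y ⟶ y') {p q : x ⟶ y} {f g : p ⟶ q} :
    E.Sim f g → E.Sim (context c f d) (context c g d)
  | ⟨a⟩ => by
    have h : E.Sim (f ▷ d) (g ▷ d) := by
      simpa [Sim] using (⟨.comp₀ a (.id (𝟙 d))⟩ : E.Sim (f ▷ d ≫ q ◁ 𝟙 d) (g ▷ d ≫ q ◁ 𝟙 d))
    obtain ⟨b⟩ := h
    simpa [Sim, TwoPolygraph.context] using (⟨.comp₀ (.id (𝟙 c)) b⟩ :
      E.Sim (𝟙 c ▷ (p ≫ d) ≫ c ◁ f ▷ d) (𝟙 c ▷ (p ≫ d) ≫ c ◁ g ▷ d))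

/-! ### Filling local branchings. -/

variable (E) in
/-- The local branching `(f, g)` can be completed into a confluence filled by a `3`-cell. -/
def Fills (f g : P.Step x y) (h : f.src = g.src) : Prop :=
  ∃ (r : x ⟶ y) (f' : RewritingSequence f.tgt r) (g' : RewritingSequence g.tgt r),
    E.Sim (f.toCell ≫ f'.toCell) (eqToHom h ≫ g.toCell ≫ g'.toCell)

theorem Fills.swap {f g : P.Step x y} {h : f.src = g.src} (H : E.Fills f g h) :
    E.Fills g f h.symm := by
  obtain ⟨r, f', g', hs⟩ := H
  exact ⟨r, g', f', by simpa using hs.symm.comp_left (eqToHom h.symm)⟩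

theorem Fills.whisker {f g : P.Step x y} {h : f.src = g.src} (H : E.Fills f g h) {x' y' : P.Free}
    (c : x' ⟶ x) (d : y ⟶ y') (h' : (f.whisker c d).src = (g.whisker c d).src) :
    E.Fills (f.whisker c d) (g.whisker c d) h' := by
  obtain ⟨r, f', g', hs⟩ := H
  refine ⟨c ≫ r ≫ d, (f'.whisker c d).copy (Step.whisker_tgt _ _ _),
    (g'.whisker c d).copy (Step.whisker_tgt _ _ _), ?_⟩
  simpa [RewritingSequence.toCell_copy, RewritingSequence.toCell_whisker,
    Step.whisker_toCell, context_comp, context_eqToHom] using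
    (hs.context c d).comp_left (eqToHom (Step.whisker_src c f d))

theorem Fills.refl (f : P.Step x y) : E.Fills f f rfl :=
  ⟨_, .nil _, .nil _, .of_eq (by simp)⟩

/-- Each step is followed by the other one, and the exchange law makes the two composites equal; no
generating `3`-cell is needed. -/
theorem Fills.peiffer {z : P.Free} (f : P.Step x z) (g : P.Step z y)
    (h : (f.whisker (𝟙 _) g.src).src = (g.whisker f.src (𝟙 _)).src) :
    E.Fills (f.whisker (𝟙 _) g.src) (g.whisker f.src (𝟙 _)) h := by
  refine ⟨f.tgt ≫ g.tgt,
    .cons (g.whisker f.tgt (𝟙 _))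
      (by simp only [Step.whisker_src, Step.whisker_tgt, Free.idComp, Free.compId])
      -- An empty sequence that only changes the expression of the endpoint to `f.tgt ≫ g.tgt`.
      (.copy (by simp only [Step.whisker_tgt, Free.compId]) (.nil _)),
    .cons (f.whisker (𝟙 _) g.tgt)
      (by simp only [Step.whisker_src, Step.whisker_tgt, Free.idComp, Free.compId])
      (.copy (by simp only [Step.whisker_tgt, Free.idComp]) (.nil _)), .of_eq ?_⟩
  have key := whisker_exchange f.toCell g.toCell
  simp only [whiskerLeft_eq_context, whiskerRight_eq_context, Category.assoc, eqToHom_trans_assoc]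
    at key
  have key' := congrArg (eqToHom (show (f.whisker (𝟙 _) g.src).src = f.src ≫ g.src by
    simp only [Step.whisker_src, Free.idComp]) ≫ ·) key
  simpa [RewritingSequence.toCell, RewritingSequence.toCell_copy, Step.whisker_toCell] using
    key'.symm

theorem IsFamilyOfGeneratingConfluences.fills (hE : E.IsFamilyOfGeneratingConfluences)
    (f g : P.Step x y) (h : f.src = g.src) : E.Fills f g h := by
  obtain ⟨branching, hb, hb'⟩ := hE
  have of_cell (A : E.Cell) (B : P.LocalBranching) (hA : branching A = B) :
      E.Fills B.fst B.snd B.src_eq := by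
    subst hA
    obtain ⟨r, f', g', hr⟩ := (hb A).2
    have hs : E.Sim (E.boundary A).fst (E.boundary A).snd := ⟨.of A⟩
    rw [hr] at hs
    exact ⟨r, f', g', hs⟩
  by_cases ha : f = g
  · subst ha; exact .refl f
  by_cases hp : LocalBranching.IsPeiffer ⟨f, g, h⟩
  · have hp' : ∃ (z : P.Free) (f' : P.Step x z) (g' : P.Step z y),
      (f = f'.whisker (𝟙 _) g'.src ∧ g = g'.whisker f'.src (𝟙 _)) ∨
      (g = f'.whisker (𝟙 _) g'.src ∧ f = g'.whisker f'.src (𝟙 _)) := hp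
    obtain ⟨z, f', g', ⟨rfl, rfl⟩ | ⟨rfl, rfl⟩⟩ := hp'
    · exact .peiffer f' g' h
    · exact (Fills.peiffer f' g' h.symm).swap
  obtain ⟨C, hC, x', y', c, d, hB⟩ := LocalBranching.IsOverlapping.exists_critical
    (B := ⟨f, g, h⟩) ⟨ha, hp⟩
  have hF : E.Fills C.fst C.snd C.src_eq := by
    obtain ⟨A, hA | hA, -⟩ := hb' C hC
    · exact of_cell A C hA
    -- The chosen `3`-cell may fill the branching in the opposite orientation.
    · exact (of_cell A C.swap hA).swap
  cases hB
  exact hF.whisker c d _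

/-! ### Reductions to a normal form. -/

/-- Two rewriting sequences from a `1`-cell to its normal form are connected by a `3`-cell. -/
theorem Sim.of_normal (hP : P.Convergent)
    (hE : ∀ {x y : P.Free} (f g : P.Step x y) h, E.Fills f g h)
    {p n : x ⟶ y} (hn : IsNormal n) (s t : RewritingSequence p n) :
    E.Sim s.toCell t.toCell := by
  induction p using (hP.2.wellFounded x y).induction with
  | _ p ih =>
    cases s with
    | nil =>
      cases t with
      | nil => exact .refl _
      | cons g hg t => exact absurd hg (hn g)
    | cons f hf s =>
      cases t with
      | nil => exact absurd hf (hn f)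
      | cons g hg t =>
        obtain ⟨r, f', g', h⟩ := hE f g (hf.trans hg.symm)
        obtain ⟨m, hm, ⟨k⟩⟩ := hP.2.exists_normal r
        -- Both `s` and `f'` followed by `k` reduce the target of `f` to a normal form, so `m = n`
        -- and the induction hypothesis applies at the targets of `f` and `g`.
        obtain rfl := Confluent.normal_unique hP.1 hn hm s (f'.append k)
        have hs := ih _ ⟨f, hf, rfl⟩ s (f'.append k)
        have ht := ih _ ⟨g, hg, rfl⟩ t (g'.append k)
        rw [RewritingSequence.toCell_append] at hs ht
        subst hf
        -- Pasting: `f s ~ f f' k ~ g g' k ~ g t`.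
        have h₁ := hs.comp_left f.toCell
        have h₂ := h.comp_right k.toCell
        have h₃ := ht.symm.comp_left (eqToHom hg.symm ≫ g.toCell)
        simp only [Category.assoc] at h₁ h₂ h₃
        simpa [RewritingSequence.toCell] using h₁.trans (h₂.trans h₃)

/-! ### Arbitrary `2`-cells and normal forms. -/

variable (E) in
/-- The `2`-cell `f` is compatible, up to a `3`-cell, with reductions to a common normal form. -/
def Coherent {p q : x ⟶ y} (f : p ⟶ q) : Prop :=
  ∃ n, IsNormal n ∧ ∃ (s : RewritingSequence p n) (t : RewritingSequence q n),
    E.Sim s.toCell (f ≫ t.toCell)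

theorem Coherent.eqToHom (hP : P.Terminating) {p q : x ⟶ y} (h : p = q) :
    E.Coherent (eqToHom h) := by
  subst h
  obtain ⟨n, hn, ⟨s⟩⟩ := hP.exists_normal p
  exact ⟨n, hn, s, s, .of_eq (by simp)⟩

/-- The two reductions of the middle `1`-cell `q` end at the same normal form, and `Sim.of_normal`
connects them. -/
theorem Coherent.comp (hP : P.Convergent)
    (hE : ∀ {x y : P.Free} (f g : P.Step x y) h, E.Fills f g h)
    {p q r : x ⟶ y} {f : p ⟶ q} {g : q ⟶ r} (hf : E.Coherent f) (hg : E.Coherent g) :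
    E.Coherent (f ≫ g) := by
  obtain ⟨n, hn, s, t, h⟩ := hf
  obtain ⟨n', hn', s', t', h'⟩ := hg
  obtain rfl := Confluent.normal_unique hP.1 hn hn' t s'
  refine ⟨n, hn, s, t', h.trans ?_⟩
  rw [Category.assoc]
  exact ((Sim.of_normal hP hE hn t s').trans h').comp_left f

theorem Coherent.inv {p q : x ⟶ y} {f : p ⟶ q} (hf : E.Coherent f) :
    E.Coherent (inv f) := by
  obtain ⟨n, hn, s, t, h⟩ := hf
  exact ⟨n, hn, t, s, by simpa using h.symm.comp_left (CategoryTheory.inv f)⟩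

theorem Coherent.step (hP : P.Terminating) (f : P.Step x y) : E.Coherent f.toCell := by
  obtain ⟨n, hn, ⟨t⟩⟩ := hP.exists_normal f.tgt
  exact ⟨n, hn, .cons f rfl t, t, .of_eq (by simp [RewritingSequence.toCell])⟩

theorem Coherent.conj {p p' q q' : x ⟶ y} {f : p ⟶ q}
    (hf : E.Coherent f) (h : p' = p) (h' : q = q') :
    E.Coherent (CategoryTheory.eqToHom h ≫ f ≫ CategoryTheory.eqToHom h') := by
  subst h h'
  simpa using hf

/-- The induction must quantify over all contexts: whiskering a normal form need not give a normal
form, so coherence of `f` alone does not pass to its whiskerings. The whiskering cases enlarge the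
context instead, and a generating `2`-cell in context is a rewriting step. -/
theorem Coherent.context_mk (hP : P.Convergent)
    (hE : ∀ {x y : P.Free} (f g : P.Step x y) h, E.Fills f g h)
    {p q : x ⟶ y}
    (f : FormalCell P p q) {x' y' : P.Free} (c : x' ⟶ x) (d : y ⟶ y') :
    E.Coherent (context c (TwoCell.mk f : p ⟶ q) d) := by
  induction f generalizing x' y' with
  | of φ => exact Coherent.step hP.2 ⟨c, φ, d⟩
  | ofEq h =>
    rw [mk_ofEq, context_eqToHom]
    exact .eqToHom hP.2 _
  | comp f g hf hg =>
    have := (hf c d).comp hP hE (hg c d)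
    rwa [← context_comp] at this
  | @inv x y p q f hf =>
    -- The formal inverse agrees with `CategoryTheory.inv` by uniqueness of inverses.
    have h₁ : (show p ⟶ q from TwoCell.mk f) ≫ (show q ⟶ p from TwoCell.mk f.inv) = 𝟙 p :=
      (homGroupoid x y).comp_inv (TwoCell.mk f)
    have h := IsIso.eq_inv_of_hom_inv_id h₁
    change E.Coherent (context c (show q ⟶ p from TwoCell.mk f.inv) d)
    rw [h, context_inv]
    exact (hf c d).inv
  | @whiskerL x y z a p q f hf =>
    have h : (TwoCell.mk (f.whiskerL a) : a ≫ p ⟶ a ≫ q) = a ◁ (TwoCell.mk f : p ⟶ q) := rfl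
    rw [h, whiskerLeft_eq_context, context_comp, context_comp, context_eqToHom, context_eqToHom,
      context_context]
    exact ((hf _ _).conj _ _).conj _ _
  | @whiskerR x y z p q f a hf =>
    have h : (TwoCell.mk (f.whiskerR a) : p ≫ a ⟶ q ≫ a) = (TwoCell.mk f : p ⟶ q) ▷ a := rfl
    rw [h, whiskerRight_eq_context, context_comp, context_comp, context_eqToHom, context_eqToHom,
      context_context]
    exact ((hf _ _).conj _ _).conj _ _

theorem Coherent.all (hP : P.Convergent)
    (hE : ∀ {x y : P.Free} (f g : P.Step x y) h, E.Fills f g h)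
    {p q : x ⟶ y} (f : p ⟶ q) :
    E.Coherent f := by
  induction f using TwoCell.ind with
  | h f =>
    have h := Coherent.context_mk hP hE f (𝟙 x) (𝟙 y)
    rw [context_one_one] at h
    simpa using h.conj (p' := p) (q' := q) (by simp only [Free.idComp, Free.compId])
      (by simp only [Free.idComp, Free.compId])

theorem IsFamilyOfGeneratingConfluences.isHomotopyBasis (hP : P.Convergent)
    (hE : E.IsFamilyOfGeneratingConfluences) : E.IsHomotopyBasis := by
  intro x y p q f g
  obtain ⟨n, hn, s, t, h⟩ := Coherent.all hP hE.fills f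
  obtain ⟨n', hn', s', t', h'⟩ := Coherent.all hP hE.fills g
  obtain rfl := Confluent.normal_unique hP.1 hn hn' s s'
  have ht := (Sim.of_normal hP hE.fills hn t' t).comp_left g
  -- `f t ~ s ~ s' ~ g t' ~ g t`, then `t` is cancelled.
  exact (h.symm.trans (((Sim.of_normal hP hE.fills hn s s').trans h').trans ht)).of_comp_right

end GlobularExtension

theorem presents_presentedCategory (P : TwoPolygraph.{u, v, w}) :
    P.Presents P.PresentedCategory := ⟨𝟭 _, 𝟭 _, rfl, rfl⟩

end TwoPolygraph

theorem mainTheorem3 (P : TwoPolygraph.{u, v, w}) (hP : P.Convergent)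
    (S : SquierCompletion.{u, v, w, t} P) :
    S.toThreeOnePolygraph.IsCoherentPresentation P.PresentedCategory :=
  ⟨P.presents_presentedCategory, S.isFamily.isHomotopyBasis hP⟩
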